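/- **Setting.** Let $(p_n)_{n\ge 0}$ be real numbers with $0<p_n<1$ and $q_n=1-p_n$. Let $\Omega=\{-1,1\}^{\mathbb N}$ with coordinate maps $\zeta_n$ and the product $\sigma$-field, and let $\mathbb P$ be the probability measure on $\Omega$ under which the $\zeta_n$ are independent with $\mathbb P(\zeta_n=1)=p_n$ and $\mathbb P(\zeta_n=-1)=q_n$. Let $\mathcal H=L^2(\Omega,\mathbb P;\mathbb C)$, $Z_n=\frac{\zeta_n+q_n-p_n}{2\sqrt{p_nq_n}}$, and $Z_\sigma=\prod_{n\in\sigma}Z_n$ for finite $\sigma\subset\mathbb N$; the $Z_\sigma$ form an orthonormal basis of $\mathcal H$. Let $\partial_n$ be the bounded operator on $\mathcal H$ with $\partial_nZ_\sigma=Z_{\sigma\setminus\{n\}}$ if $n\in\sigma$ and $\partial_nZ_\sigma=0$ if $n\notin\sigma$, and put $$L_n=\tfrac12(\partial_n^*+\partial_n-I),\qquad R_n=\tfrac12(\partial_n^*+\partial_n+I),\qquad B_n^{(-1)}=L_n,\quad B_n^{(+1)}=R_n .$$ Let $d\ge 2$, let $\mathcal H^{\otimes d}$ be the $d$-fold Hilbert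 space tensor power, and let $\mathsf K\colon\mathcal H^{\otimes d}\to\mathcal H$ be a unitary isomorphism. For $\varepsilon\in\{-1,1\}^d$ put $C_n^{(\varepsilon)}=\mathsf K\big(\bigotimes_{j=1}^dB_n^{(\varepsilon_j)}\big)\mathsf K^{-1}$. A *$d$-dimensional nucleus* (respectively *1-dimensional nucleus*) is a map $\omega$ from $\mathbb Z^d$ (respectively $\mathbb Z$) to the positive trace class operators on $\mathcal H$ with $\sum_x\mathrm{Tr}[\omega(x)]=1$. The *$d$-dimensional open QBN walk* with initial nucleus $\omega^{(0)}$ is described by the nuclei given by $$\omega^{(n+1)}(x)=\sum_{\varepsilon\in\{-1,1\}^d}C_n^{(\varepsilon)}\,\omega^{(n)}(x-\varepsilon)\,C_n^{(\varepsilon)},\qquad x\in\mathbb Z^d,\ n\ge 0 .$$ A 1-dimensional nucleus $\rho$ is *regular* if the sequence $\rho^{(0)}=\rho$, $\rho^{(n+1)}(x)=L_n\rho^{(n)}(x+1)L_n+R_n\rho^{(n)}(x-1)R_n$ satisfies $$\lim_{n\to\infty}\sum_{x\in\mathbb Z}e^{\mathrm i tx/\sqrt n}\,\mathrm{Tr}[\rho^{(n)}(x)]=e^{-t^2/2}\qquad\text{for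 all }t\in\mathbb R .$$ **Theorem.** Let $(\omega^{(n)})_{n\ge 0}$ be the nuclei of the $d$-dimensional open QBN walk, and suppose that $$\omega^{(0)}(x)=\mathsf K\Big(\bigotimes_{j=1}^d\rho_j^{(0)}(x_j)\Big)\mathsf K^{-1},\qquad x=(x_1,\dots,x_d)\in\mathbb Z^d,$$ where $\rho_1^{(0)},\dots,\rho_d^{(0)}$ are regular 1-dimensional nuclei. For each $n\ge 0$ let $X_n$ be a $\mathbb Z^d$-valued random vector with $P\{X_n=x\}=\mathrm{Tr}[\omega^{(n)}(x)]$ for all $x\in\mathbb Z^d$. Then, as $n\to\infty$, $X_n/\sqrt n$ converges in law to the standard $d$-dimensional Gaussian distribution $N(0,I_{d\times d})$. -/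

import Mathlib

open MeasureTheory ProbabilityTheory Filter
open scoped Topology ComplexOrder ENNReal

noncomputable section

namespace OpenQBN

section Bernoulli

/-- `Ω = {-1, 1}^ℕ`; the set `{-1, 1}` is the group of units of `ℤ`. -/
abbrev Path : Type := ℕ → ℤˣ

/-- The law on `{-1, 1}` with mass `p` at `1` and mass `1 - p` at `-1`. -/
def coinMeasure (p : Set.Ioo (0 : ℝ) 1) : Measure ℤˣ :=
  ENNReal.ofReal p • Measure.dirac 1 + ENNReal.ofReal (1 - p) • Measure.dirac (-1)

instance (p : Set.Ioo (0 : ℝ) 1) : IsProbabilityMeasure (coinMeasure p) := by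
  constructor
  simp [coinMeasure]
  rw [← ENNReal.ofReal_add p.2.1.le (by linarith [p.2.2])]
  simp

/-- The product measure on `Ω` under which the coordinates are independent with
`P(ζ_n = 1) = p n` and `P(ζ_n = -1) = 1 - p n`. -/
def bernoulliMeasure (p : ℕ → Set.Ioo (0 : ℝ) 1) : Measure Path :=
  Measure.infinitePi fun n => coinMeasure (p n)

instance (p : ℕ → Set.Ioo (0 : ℝ) 1) : IsProbabilityMeasure (bernoulliMeasure p) :=
  inferInstanceAs (IsProbabilityMeasure (Measure.infinitePi fun n => coinMeasure (p n)))

/-- The Hilbert space of square integrable complex Bernoulli functionals. -/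
abbrev H (p : ℕ → Set.Ioo (0 : ℝ) 1) : Type := Lp ℂ 2 (bernoulliMeasure p)

/-- The standardised coordinate value `(ε + q - p) / (2 √(p q))` with `q = 1 - p`. -/
def coinZ (p : Set.Ioo (0 : ℝ) 1) (ε : ℤˣ) : ℝ :=
  (((ε : ℤ) : ℝ) + (1 - p) - p) / (2 * √(p * (1 - p)))

/-- The Bernoulli functional `Z_σ = ∏ n ∈ σ, Z_n`, where `Z_n = (ζ_n + q_n - p_n) / (2 √(p_n q_n))`,
as a function on `Ω`. -/
def bernoulliFun (p : ℕ → Set.Ioo (0 : ℝ) 1) (σ : Finset ℕ) (f : Path) : ℂ :=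
  ∏ n ∈ σ, (coinZ (p n) (f n) : ℂ)

instance : MeasurableSingletonClass ℤˣ :=
  ⟨fun a => ⟨{(a : ℤ)}, measurableSet_singleton _, by ext; simp [Units.ext_iff]⟩⟩
 

lemma continuous_bernoulliFun (p : ℕ → Set.Ioo (0 : ℝ) 1) (σ : Finset ℕ) :
    Continuous (bernoulliFun p σ) := by
  refine continuous_finsetProd _ fun n _ => ?_
  exact (continuous_of_discreteTopology (f := fun ε : ℤˣ => (coinZ (p n) ε : ℂ))).comp
    (continuous_apply n)

/-- `Z_σ` as an element of `H`. -/
def Zvec (p : ℕ → Set.Ioo (0 : ℝ) 1) (σ : Finset ℕ) : H p :=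
  ContinuousMap.toLp 2 (bernoulliMeasure p) ℂ ⟨bernoulliFun p σ, continuous_bernoulliFun p σ⟩

lemma coeFn_Zvec (p : ℕ → Set.Ioo (0 : ℝ) 1) (σ : Finset ℕ) :
    Zvec p σ =ᵐ[bernoulliMeasure p] bernoulliFun p σ :=
  ContinuousMap.coeFn_toLp (p := 2) (𝕜 := ℂ) (bernoulliMeasure p)
    (⟨bernoulliFun p σ, continuous_bernoulliFun p σ⟩ : C(Path, ℂ))

lemma integral_coin (p : Set.Ioo (0 : ℝ) 1) (g : ℤˣ → ℂ) :
    ∫ ε, g ε ∂(coinMeasure p) = p * g 1 + (1 - p) * g (-1) := by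
  have h1 : Integrable g (ENNReal.ofReal p • Measure.dirac (1 : ℤˣ)) :=
    Integrable.smul_measure (integrable_dirac (by simp)) ENNReal.ofReal_ne_top
  have h2 : Integrable g (ENNReal.ofReal (1 - p) • Measure.dirac (-1 : ℤˣ)) :=
    Integrable.smul_measure (integrable_dirac (by simp)) ENNReal.ofReal_ne_top
  rw [coinMeasure, integral_add_measure h1 h2, integral_smul_measure, integral_smul_measure,
    integral_dirac, integral_dirac]
  simp [ENNReal.toReal_ofReal, p.2.1.le, p.2.2.le]

lemma integral_coinZ (p : Set.Ioo (0 : ℝ) 1) : ∫ ε, (coinZ p ε : ℂ) ∂(coinMeasure p) = 0 := by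
  rw [integral_coin]
  norm_cast
  simp [coinZ]
  ring

lemma integral_coinZ_mul (p : Set.Ioo (0 : ℝ) 1) :
    ∫ ε, (coinZ p ε : ℂ) * (coinZ p ε : ℂ) ∂(coinMeasure p) = 1 := by
  rw [integral_coin]
  norm_cast
  have h0 : (0 : ℝ) < p := p.2.1
  have h1 : (0 : ℝ) < 1 - p := sub_pos.2 p.2.2
  have h2 := Real.mul_self_sqrt (mul_pos h0 h1).le
  have h3 : (0 : ℝ) < √(p * (1 - p)) := Real.sqrt_pos.2 (mul_pos h0 h1)
  set s := √((p : ℝ) * (1 - p))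
  simp only [coinZ]
  push_cast
  rw [div_mul_div_comm, div_mul_div_comm, show 2 * s * (2 * s) = 4 * (p * (1 - p)) by rw [← h2]; ring]
  field_simp
  ring

lemma inner_Zvec (p : ℕ → Set.Ioo (0 : ℝ) 1) (σ τ : Finset ℕ) :
    inner ℂ (Zvec p σ) (Zvec p τ) = if σ = τ then 1 else 0 := by
  rw [MeasureTheory.L2.inner_def]
  let h : ℕ → ℤˣ → ℂ := fun n ε =>
    (if n ∈ σ then (coinZ (p n) ε : ℂ) else 1) * (if n ∈ τ then (coinZ (p n) ε : ℂ) else 1)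
  have e : (fun f => inner ℂ (Zvec p σ f) (Zvec p τ f)) =ᵐ[bernoulliMeasure p]
      fun f => ∏ n : ↥(σ ∪ τ), h n (f n) := by
    filter_upwards [coeFn_Zvec p σ, coeFn_Zvec p τ] with f h1 h2
    rw [h1, h2, Finset.prod_coe_sort (σ ∪ τ) (fun n => h n (f n)), Finset.prod_mul_distrib,
      Finset.prod_ite_mem, Finset.prod_ite_mem, Finset.union_inter_cancel_left,
      Finset.union_inter_cancel_right]
    simp [bernoulliFun, mul_comm]
  rw [integral_congr_ae e, bernoulliMeasure]
  have e2 := integral_restrict_infinitePi (μ := fun n => coinMeasure (p n)) (s := σ ∪ τ)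
    (f := fun y => ∏ n : ↥(σ ∪ τ), h n (y n))
    (Measurable.of_discrete.aestronglyMeasurable)
  refine e2.trans ?_
  rw [integral_fintype_prod_eq_prod (f := fun (n : ↥(σ ∪ τ)) ε => h n ε),
    Finset.prod_coe_sort (σ ∪ τ) (fun n => ∫ ε, h n ε ∂(coinMeasure (p n)))]
  split_ifs with hst
  · subst hst
    refine Finset.prod_eq_one fun n hn => ?_
    have hn' : n ∈ σ := by simpa using hn
    simpa [h, hn'] using integral_coinZ_mul (p n)
  · obtain ⟨n, hn⟩ : ∃ n, ¬ (n ∈ σ ↔ n ∈ τ) := by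
      by_contra! hc
      exact hst (Finset.ext hc)
    refine Finset.prod_eq_zero (i := n) (by simp; tauto) ?_
    by_cases h1 : n ∈ σ
    · have h2 : n ∉ τ := by tauto
      simpa [h, h1, h2] using integral_coinZ (p n)
    · have h2 : n ∈ τ := by tauto
      simpa [h, h1, h2] using integral_coinZ (p n)

lemma orthonormal_Zvec (p : ℕ → Set.Ioo (0 : ℝ) 1) : Orthonormal ℂ (Zvec p) :=
  orthonormal_iff_ite.2 fun σ τ => inner_Zvec p σ τ

/-- `Z_σ` as a continuous function on `Ω`. -/
def Zcont (p : ℕ → Set.Ioo (0 : ℝ) 1) (σ : Finset ℕ) : C(Path, ℂ) :=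
  ⟨bernoulliFun p σ, continuous_bernoulliFun p σ⟩

/-- `Z_n² = 1 + c Z_n` for a constant `c`. -/
lemma coinZ_mul_self (p : Set.Ioo (0 : ℝ) 1) :
    ∃ c : ℝ, ∀ ε, coinZ p ε * coinZ p ε = 1 + c * coinZ p ε := by
  have h0 : (0 : ℝ) < p := p.2.1
  have h1 : (0 : ℝ) < 1 - p := sub_pos.2 p.2.2
  have h2 := Real.mul_self_sqrt (mul_pos h0 h1).le
  have h3 : (0 : ℝ) < √(p * (1 - p)) := Real.sqrt_pos.2 (mul_pos h0 h1)
  refine ⟨(1 - 2 * p) / √(p * (1 - p)), fun ε => ?_⟩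
  simp only [coinZ]
  set s := √((p : ℝ) * (1 - p))
  rcases Int.units_eq_one_or ε with rfl | rfl <;> field_simp <;> push_cast <;>
    nlinarith [h2]

lemma coinZ_injective (p : Set.Ioo (0 : ℝ) 1) : Function.Injective (coinZ p) := by
  intro a b hab
  have h3 : (0 : ℝ) < √(p * (1 - p)) :=
    Real.sqrt_pos.2 (mul_pos p.2.1 (sub_pos.2 p.2.2))
  simp only [coinZ] at hab
  rw [div_left_inj' (by positivity)] at hab
  have : (((a : ℤ) : ℝ)) = ((b : ℤ) : ℝ) := by linarith
  exact Units.ext (by exact_mod_cast this)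

lemma Zcont_mul_mem (p : ℕ → Set.Ioo (0 : ℝ) 1) (n : ℕ) (v : C(Path, ℂ))
    (hv : v ∈ Submodule.span ℂ (Set.range (Zcont p))) :
    Zcont p {n} * v ∈ Submodule.span ℂ (Set.range (Zcont p)) := by
  induction hv using Submodule.span_induction with
  | zero => simp
  | add x y _ _ hx hy => rw [mul_add]; exact add_mem hx hy
  | smul a x _ hx => rw [mul_smul_comm]; exact Submodule.smul_mem _ _ hx
  | mem x hx =>
    obtain ⟨σ, rfl⟩ := hx
    by_cases hn : n ∈ σ
    · obtain ⟨c, hc⟩ := coinZ_mul_self (p n)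
      have : Zcont p {n} * Zcont p σ = Zcont p (σ.erase n) + (c : ℂ) • Zcont p σ := by
        ext f
        have h := hc (f n)
        have h' : (coinZ (p n) (f n) : ℂ) * coinZ (p n) (f n) = 1 + c * coinZ (p n) (f n) := by
          exact_mod_cast h
        simp only [Zcont, bernoulliFun, ContinuousMap.mul_apply, ContinuousMap.coe_mk,
          Finset.prod_singleton, ContinuousMap.add_apply, ContinuousMap.smul_apply, smul_eq_mul]
        rw [← Finset.mul_prod_erase σ _ hn, ← mul_assoc, h']
        ring
      rw [this]
      exact add_mem (Submodule.subset_span ⟨_, rfl⟩)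
        (Submodule.smul_mem _ _ (Submodule.subset_span ⟨_, rfl⟩))
    · have : Zcont p {n} * Zcont p σ = Zcont p (insert n σ) := by
        ext f
        simp [Zcont, bernoulliFun, Finset.prod_insert hn]
      rw [this]
      exact Submodule.subset_span ⟨_, rfl⟩

lemma dense_span_Zcont (p : ℕ → Set.Ioo (0 : ℝ) 1) :
    Dense (Submodule.span ℂ (Set.range (Zcont p)) : Set C(Path, ℂ)) := by
  let S : Set C(Path, ℂ) := Set.range fun n => Zcont p {n}
  have hS : ∀ x ∈ S, star x = x := by
    rintro _ ⟨n, rfl⟩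
    ext f
    simp [Zcont, bernoulliFun]
  have hle : ∀ x ∈ Algebra.adjoin ℂ S, x ∈ Submodule.span ℂ (Set.range (Zcont p)) := by
    intro x hx
    have hx' : x ∈ Submodule.span ℂ (Submonoid.closure S : Set C(Path, ℂ)) := by
      rw [← Algebra.adjoin_eq_span]; exact hx
    refine Submodule.span_le.2 ?_ hx'
    intro y hy
    induction hy using Submonoid.closure_induction_left with
    | one =>
      refine Submodule.subset_span ⟨∅, ?_⟩
      ext f
      simp [Zcont, bernoulliFun]
    | mul_left a ha b _ hb =>
      obtain ⟨n, rfl⟩ := ha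
      exact Zcont_mul_mem p n b hb
  let A : StarSubalgebra ℂ C(Path, ℂ) :=
    { Algebra.adjoin ℂ S with
      star_mem' := by
        intro a ha
        change star a ∈ Algebra.adjoin ℂ S
        induction ha using Algebra.adjoin_induction with
        | mem x hx => rw [hS x hx]; exact Algebra.subset_adjoin hx
        | algebraMap r =>
          rw [← algebraMap_star_comm]
          exact Subalgebra.algebraMap_mem _ _
        | add x y _ _ hx hy => rw [star_add]; exact add_mem hx hy
        | mul x y _ _ hx hy => rw [star_mul]; exact mul_mem hy hx }
  have hA : A.SeparatesPoints := by
    intro f g hfg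
    obtain ⟨n, hn⟩ := Function.ne_iff.1 hfg
    refine ⟨Zcont p {n}, ⟨Zcont p {n}, Algebra.subset_adjoin ⟨n, rfl⟩, rfl⟩, ?_⟩
    simp only [Zcont, bernoulliFun, ContinuousMap.coe_mk, Finset.prod_singleton]
    exact fun h => hn (coinZ_injective (p n) (by exact_mod_cast h))
  have htop := ContinuousMap.starSubalgebra_topologicalClosure_eq_top_of_separatesPoints A hA
  have hd : Dense (A : Set C(Path, ℂ)) := by
    rw [dense_iff_closure_eq, ← StarSubalgebra.topologicalClosure_coe, htop]
    rfl
  exact hd.mono hle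

lemma span_Zvec_closure (p : ℕ → Set.Ioo (0 : ℝ) 1) :
    ⊤ ≤ (Submodule.span ℂ (Set.range (Zvec p))).topologicalClosure := by
  have h := (ContinuousMap.toLp_denseRange ℂ (bernoulliMeasure p) ℂ (p := 2)
    (by simp)).dense_image (ContinuousLinearMap.continuous _) (dense_span_Zcont p)
  intro x _
  have hx := h x
  refine closure_mono ?_ hx
  rintro _ ⟨v, hv, rfl⟩
  induction hv using Submodule.span_induction with
  | zero => simp
  | add x y _ _ hx hy => rw [map_add]; exact add_mem hx hy
  | smul a x _ hx => rw [map_smul]; exact Submodule.smul_mem _ _ hx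
  | mem x hx =>
    obtain ⟨σ, rfl⟩ := hx
    exact Submodule.subset_span ⟨σ, rfl⟩

/-- The canonical orthonormal basis `(Z_σ)` of `H`, indexed by the finite subsets of `ℕ`. -/
def canonicalBasis (p : ℕ → Set.Ioo (0 : ℝ) 1) : HilbertBasis (Finset ℕ) ℂ (H p) :=
  HilbertBasis.mk (orthonormal_Zvec p) (span_Zvec_closure p)

lemma canonicalBasis_apply (p : ℕ → Set.Ioo (0 : ℝ) 1) (σ : Finset ℕ) :
    canonicalBasis p σ = Zvec p σ := by
  simp [canonicalBasis]

/-- The involution `σ ↦ σ ∆ {k}` of the finite subsets of `ℕ`. -/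
def toggle (k : ℕ) : Equiv.Perm (Finset ℕ) :=
  (symmDiff_left_involutive ({k} : Finset ℕ)).toPerm

lemma toggle_of_notMem {k : ℕ} {σ : Finset ℕ} (h : k ∉ σ) : toggle k σ = insert k σ := by
  ext n
  simp only [toggle, Function.Involutive.coe_toPerm, Finset.mem_symmDiff, Finset.mem_singleton,
    Finset.mem_insert]
  by_cases hn : n = k <;> simp_all

lemma coeffAnnihilation_le (k : ℕ) (a : lp (fun _ : Finset ℕ => ℂ) 2) (σ : Finset ℕ) :
    ‖if k ∈ σ then 0 else a (insert k σ)‖ ^ (2 : ℝ≥0∞).toReal ≤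
      ‖a (toggle k σ)‖ ^ (2 : ℝ≥0∞).toReal := by
  split_ifs with h
  · simp
  · rw [toggle_of_notMem h]

lemma summable_toggle (k : ℕ) (a : lp (fun _ : Finset ℕ => ℂ) 2) :
    Summable fun σ => ‖a (toggle k σ)‖ ^ (2 : ℝ≥0∞).toReal :=
  (toggle k).summable_iff.2 ((lp.memℓp a).summable (by simp))

/-- The operator on coefficient sequences induced by annihilation at `k`:
`(a_σ) ↦ (𝟙[k ∉ σ] a_{σ ∪ {k}})`. -/
def coeffAnnihilation (k : ℕ) :
    lp (fun _ : Finset ℕ => ℂ) 2 →L[ℂ] lp (fun _ : Finset ℕ => ℂ) 2 :=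
  LinearMap.mkContinuous
    { toFun := fun a => ⟨fun σ => if k ∈ σ then 0 else a (insert k σ),
        memℓp_gen ((summable_toggle k a).of_nonneg_of_le (fun _ => by positivity)
          (coeffAnnihilation_le k a))⟩
      map_add' := fun a b => by
        ext σ
        change (if k ∈ σ then 0 else (a + b) (insert k σ)) =
          (if k ∈ σ then 0 else a (insert k σ)) + (if k ∈ σ then 0 else b (insert k σ))
        by_cases h : k ∈ σ <;> simp [h]
      map_smul' := fun c a => by
        ext σ
        by_cases h : k ∈ σ <;> simp [h] }
    1 (fun a => by
      rw [one_mul]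
      refine lp.norm_le_of_tsum_le (by simp) (norm_nonneg a) ?_
      rw [lp.norm_rpow_eq_tsum (by simp) a,
        ← (toggle k).tsum_eq fun σ => ‖a σ‖ ^ (2 : ℝ≥0∞).toReal]
      exact Summable.tsum_le_tsum (coeffAnnihilation_le k a)
        ((summable_toggle k a).of_nonneg_of_le (fun _ => by positivity)
          (coeffAnnihilation_le k a)) (summable_toggle k a))

/-- The annihilation operator `∂_k` on `H`: the bounded operator with
`∂_k Z_σ = Z_{σ \ {k}}` if `k ∈ σ` and `∂_k Z_σ = 0` otherwise (see `annihilation_Zvec`). -/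
def annihilation (p : ℕ → Set.Ioo (0 : ℝ) 1) (k : ℕ) : H p →L[ℂ] H p :=
  ((canonicalBasis p).repr.symm.toContinuousLinearEquiv : _ →L[ℂ] H p) ∘L
    coeffAnnihilation k ∘L ((canonicalBasis p).repr.toContinuousLinearEquiv : H p →L[ℂ] _)

lemma annihilation_Zvec (p : ℕ → Set.Ioo (0 : ℝ) 1) (k : ℕ) (σ : Finset ℕ) :
    annihilation p k (Zvec p σ) = if k ∈ σ then Zvec p (σ.erase k) else 0 := by
  apply (canonicalBasis p).repr.injective
  ext τ
  have h1 : ∀ ρ, (canonicalBasis p).repr (Zvec p ρ) = lp.single 2 ρ (1 : ℂ) := fun ρ => by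
    rw [← canonicalBasis_apply, HilbertBasis.repr_self]
  have h2 : ∀ ρ ρ' : Finset ℕ, (lp.single 2 ρ (1 : ℂ) : lp (fun _ : Finset ℕ => ℂ) 2) ρ' =
      if ρ' = ρ then 1 else 0 := fun ρ ρ' => by
    simp [lp.single_apply, Pi.single_apply]
  have h3 : ∀ a : lp (fun _ : Finset ℕ => ℂ) 2,
      coeffAnnihilation k a τ = if k ∈ τ then 0 else a (insert k τ) := fun _ => rfl
  have h4 : ∀ a, (canonicalBasis p).repr ((canonicalBasis p).repr.symm a) = a :=
    fun a => LinearIsometryEquiv.apply_symm_apply _ _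
  change (canonicalBasis p).repr ((canonicalBasis p).repr.symm
    (coeffAnnihilation k ((canonicalBasis p).repr (Zvec p σ)))) τ = _
  rw [h4, h3, h1, h2]
  by_cases hσ : k ∈ σ
  · rw [if_pos hσ, h1, h2]
    by_cases hτ : k ∈ τ
    · have : τ ≠ σ.erase k := fun h => Finset.notMem_erase k σ (h ▸ hτ)
      simp [hτ, this]
    · have : insert k τ = σ ↔ τ = σ.erase k :=
        ⟨fun h => by rw [← h, Finset.erase_insert hτ], fun h => by rw [h, Finset.insert_erase hσ]⟩
      simp [hτ, this]
  · have : insert k τ ≠ σ := fun h => hσ (h ▸ Finset.mem_insert_self k τ)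
    simp [hσ, this]

end Bernoulli

section HilbertTensor
variable {ι E : Type*} [Fintype ι] [NormedAddCommGroup E] [InnerProductSpace ℂ E]

/-- The algebraic tensor power `E ⊗ ⋯ ⊗ E` over the index set `ι` (without the projective seminorm
that Mathlib puts on `PiTensorProduct`). -/
def AlgTensor (ι E : Type*) [Fintype ι] [NormedAddCommGroup E] [InnerProductSpace ℂ E] : Type _ :=
  PiTensorProduct ℂ (fun _ : ι => E)

instance : AddCommGroup (AlgTensor ι E) :=
  inferInstanceAs (AddCommGroup (PiTensorProduct ℂ (fun _ : ι => E)))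

instance : Module ℂ (AlgTensor ι E) :=
  inferInstanceAs (Module ℂ (PiTensorProduct ℂ (fun _ : ι => E)))

/-- The pure tensor `⨂ j, x j`, as a multilinear map. -/
def algTprod (ι E : Type*) [Fintype ι] [NormedAddCommGroup E] [InnerProductSpace ℂ E] :
    MultilinearMap ℂ (fun _ : ι => E) (AlgTensor ι E) :=
  PiTensorProduct.tprod ℂ

/-- The linear functional `⨂ y ↦ ∏ j, ⟪x j, y j⟫`. -/
def innerPureLeft (x : ι → E) : AlgTensor ι E →ₗ[ℂ] ℂ :=
  PiTensorProduct.lift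
    ((MultilinearMap.mkPiAlgebra ℂ ι ℂ).compLinearMap fun j => (innerSL ℂ (x j)).toLinearMap)

lemma innerPureLeft_algTprod (x y : ι → E) :
    innerPureLeft x (algTprod ι E y) = ∏ j, inner ℂ (x j) (y j) := by
  rw [innerPureLeft, algTprod]
  erw [PiTensorProduct.lift.tprod]
  simp

lemma star_innerPureLeft (x y : ι → E) :
    star (innerPureLeft y (algTprod ι E x)) = innerPureLeft x (algTprod ι E y) := by
  rw [innerPureLeft_algTprod, innerPureLeft_algTprod]
  simp [star_prod]

lemma algTensor_exists_sum (t : AlgTensor ι E) :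
    ∃ (s : Finset (ι → E)) (c : s → ℂ), t = ∑ a : s, c a • algTprod ι E a.1 := by
  have h : t ∈ Submodule.span ℂ (Set.range (algTprod ι E)) := by
    have := PiTensorProduct.span_tprod_eq_top (R := ℂ) (s := fun _ : ι => E)
    exact (this.symm ▸ Submodule.mem_top : t ∈ Submodule.span ℂ (Set.range _))
  obtain ⟨c, hc⟩ := Finsupp.mem_span_range_iff_exists_finsupp.1 h
  refine ⟨c.support, fun a => c a.1, ?_⟩
  rw [← hc, Finsupp.sum]
  exact (Finset.sum_coe_sort c.support (fun a => c a • algTprod ι E a)).symm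

lemma algTensor_hom_ext {V : Type*} [AddCommMonoid V] {f g : AlgTensor ι E →+ V}
    (h : ∀ (c : ℂ) x, f (c • algTprod ι E x) = g (c • algTprod ι E x)) : f = g := by
  ext t
  obtain ⟨s, c, rfl⟩ := algTensor_exists_sum t
  simp [map_sum, h]

/-- The sesquilinear form on the algebraic tensor power, linear in the first displayed argument and
conjugate linear in the second: `innerAux (⨂ y) (⨂ x) = ∏ j, ⟪x j, y j⟫`. -/
def innerAux : AlgTensor ι E →ₗ[ℂ] AlgTensor ι E →ₛₗ[starRingEnd ℂ] ℂ :=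
  PiTensorProduct.lift
    { toFun := fun y => (starLinearEquiv ℂ (A := ℂ)).toLinearMap.comp (innerPureLeft y)
      map_update_add' := by
        intro _ m i u v
        apply LinearMap.toAddMonoidHom_injective
        refine algTensor_hom_ext fun c x => ?_
        simp [star_innerPureLeft, -RCLike.star_def, mul_add]
      map_update_smul' := by
        intro _ m i a u
        apply LinearMap.toAddMonoidHom_injective
        refine algTensor_hom_ext fun c x => ?_
        simp [star_innerPureLeft, -RCLike.star_def, mul_left_comm] }

lemma innerAux_algTprod (x y : ι → E) :
    innerAux (algTprod ι E y) (algTprod ι E x) = ∏ j, inner ℂ (x j) (y j) := by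
  rw [innerAux, algTprod]
  erw [PiTensorProduct.lift.tprod]
  exact (star_innerPureLeft x y).trans (innerPureLeft_algTprod x y)

lemma innerAux_sum {s : Finset (ι → E)} (c c' : s → ℂ) (f g : s → ι → E) :
    innerAux (∑ b, c b • algTprod ι E (g b)) (∑ a, c' a • algTprod ι E (f a)) =
      star c' ⬝ᵥ ((Matrix.of fun a b => ∏ j, inner ℂ (f a j) (g b j)).mulVec c) := by
  simp only [map_sum, LinearMap.sum_apply, map_smul, LinearMap.map_smulₛₗ, LinearMap.smul_apply,
    innerAux_algTprod, dotProduct, Matrix.mulVec, Finset.mul_sum, smul_eq_mul, Matrix.of_apply,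
    Pi.star_apply, RCLike.star_def]
  refine Finset.sum_congr rfl fun a _ => Finset.sum_congr rfl fun b _ => by ring

/-- Entrywise products of positive semidefinite matrices are monotone. -/
lemma posSemidef_prod_sub {κ ι' : Type*} [Fintype κ] (J : Finset ι') (M N : ι' → Matrix κ κ ℂ)
    (hN : ∀ j, (N j).PosSemidef) (hMN : ∀ j, (M j - N j).PosSemidef) :
    (Matrix.of fun a b => ∏ j ∈ J, N j a b).PosSemidef ∧
      (Matrix.of fun a b => ∏ j ∈ J, M j a b - ∏ j ∈ J, N j a b).PosSemidef := by
  classical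
  have hM : ∀ j, (M j).PosSemidef := fun j => by simpa using (hMN j).add (hN j)
  induction J using Finset.induction_on with
  | empty =>
    constructor
    · simpa [Matrix.gram] using! Matrix.posSemidef_gram ℂ (fun _ : κ => (1 : ℂ))
    · simpa using! (Matrix.PosSemidef.zero : (0 : Matrix κ κ ℂ).PosSemidef)
  | insert i J hi ih =>
    constructor
    · have e : (Matrix.of fun a b => ∏ j ∈ insert i J, N j a b) =
          (N i).hadamard (Matrix.of fun a b => ∏ j ∈ J, N j a b) := by
        ext a b
        simp [Finset.prod_insert hi]
      rw [e]
      exact (hN i).hadamard ih.1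
    · have e : (Matrix.of fun a b => ∏ j ∈ insert i J, M j a b - ∏ j ∈ insert i J, N j a b) =
          (M i).hadamard (Matrix.of fun a b => ∏ j ∈ J, M j a b - ∏ j ∈ J, N j a b) +
            (M i - N i).hadamard (Matrix.of fun a b => ∏ j ∈ J, N j a b) := by
        ext a b
        simp [Finset.prod_insert hi]
        ring
      rw [e]
      exact ((hM i).hadamard ih.2).add ((hMN i).hadamard ih.1)

/-- The positive semidefinite inner product on the algebraic tensor power, determined by
`⟪⨂ x, ⨂ y⟫ = ∏ j, ⟪x j, y j⟫`. -/
abbrev algTensorCore (ι E : Type*) [Fintype ι] [NormedAddCommGroup E] [InnerProductSpace ℂ E] :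
    PreInnerProductSpace.Core ℂ (AlgTensor ι E) where
  inner x y := innerAux y x
  conj_inner_symm x y := by
    obtain ⟨s, c, rfl⟩ := algTensor_exists_sum x
    obtain ⟨t, e, rfl⟩ := algTensor_exists_sum y
    simp only [map_sum, LinearMap.sum_apply, map_smul, LinearMap.map_smulₛₗ, LinearMap.smul_apply,
      innerAux_algTprod, smul_eq_mul, map_mul, map_prod, inner_conj_symm, RCLike.conj_conj,
      Finset.mul_sum]
    rw [Finset.sum_comm]
    refine Finset.sum_congr rfl fun a _ => Finset.sum_congr rfl fun b _ => by ring
  re_inner_nonneg x := by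
    obtain ⟨s, c, rfl⟩ := algTensor_exists_sum x
    rw [innerAux_sum]
    refine (RCLike.nonneg_iff.1 (Matrix.PosSemidef.dotProduct_mulVec_nonneg ?_ c)).1
    have h := fun j => Matrix.posSemidef_gram ℂ (fun a : s => a.1 j)
    exact (posSemidef_prod_sub Finset.univ (fun j => Matrix.gram ℂ (fun a : s => a.1 j))
      (fun j => Matrix.gram ℂ (fun a : s => a.1 j)) h
      fun j => by rw [sub_self]; exact Matrix.PosSemidef.zero).1
  add_left x y z := by simp
  smul_left x y r := by simp

instance : SeminormedAddCommGroup (AlgTensor ι E) :=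
  @InnerProductSpace.Core.toSeminormedAddCommGroup ℂ _ _ _ _ (algTensorCore ι E)

instance : InnerProductSpace ℂ (AlgTensor ι E) :=
  InnerProductSpace.ofCore (algTensorCore ι E)

lemma inner_algTprod (x y : ι → E) :
    inner ℂ (algTprod ι E x) (algTprod ι E y) = ∏ j, inner ℂ (x j) (y j) :=
  innerAux_algTprod x y

/-- The Hilbert space tensor power `E ⊗ ⋯ ⊗ E` (factors indexed by `ι`): the completion of the
algebraic tensor power for the inner product `⟪⨂ x, ⨂ y⟫ = ∏ j, ⟪x j, y j⟫`. -/
abbrev HilbertTensor (ι E : Type*) [Fintype ι] [NormedAddCommGroup E] [InnerProductSpace ℂ E] :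
    Type _ :=
  UniformSpace.Completion (AlgTensor ι E)

/-- The pure tensor `⨂ j, x j` in the Hilbert space tensor power. -/
def tprod (x : ι → E) : HilbertTensor ι E := (algTprod ι E x : AlgTensor ι E)

/-- The algebraic tensor product of operators. -/
def algTensorMap (A : ι → E →L[ℂ] E) : AlgTensor ι E →ₗ[ℂ] AlgTensor ι E :=
  PiTensorProduct.map fun j => (A j).toLinearMap

lemma algTensorMap_algTprod (A : ι → E →L[ℂ] E) (x : ι → E) :
    algTensorMap A (algTprod ι E x) = algTprod ι E fun j => A j (x j) := by
  rw [algTensorMap, algTprod]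
  exact PiTensorProduct.map_tprod _ _

lemma norm_algTensorMap_le (A : ι → E →L[ℂ] E) (t : AlgTensor ι E) :
    ‖algTensorMap A t‖ ≤ (∏ j, ‖A j‖) * ‖t‖ := by
  obtain ⟨s, c, rfl⟩ := algTensor_exists_sum t
  refine le_of_sq_le_sq ?_ (by positivity)
  rw [mul_pow, @norm_sq_eq_re_inner ℂ, @norm_sq_eq_re_inner ℂ]
  simp only [map_sum, map_smul, algTensorMap_algTprod]
  change RCLike.re (innerAux _ _) ≤ _ * RCLike.re (innerAux _ _)
  rw [innerAux_sum, innerAux_sum]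
  have hG : ∀ (f : s → E), (Matrix.gram ℂ f).PosSemidef := Matrix.posSemidef_gram ℂ
  have key := (posSemidef_prod_sub Finset.univ
    (fun j => ((‖A j‖ ^ 2 : ℝ) : ℂ) • Matrix.gram ℂ (fun a : s => a.1 j))
    (fun j => Matrix.gram ℂ (fun a : s => A j (a.1 j))) (fun j => hG _) fun j => ?_).2
  · have h := (RCLike.nonneg_iff.1 (key.dotProduct_mulVec_nonneg c)).1
    have e : (Matrix.of fun a b : s => ∏ j, (((‖A j‖ ^ 2 : ℝ) : ℂ) •
        Matrix.gram ℂ (fun a : s => a.1 j)) a b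
        - ∏ j, Matrix.gram ℂ (fun a : s => A j (a.1 j)) a b) =
        (((∏ j, ‖A j‖) ^ 2 : ℝ) : ℂ) • (Matrix.of fun a b : s => ∏ j, inner ℂ (a.1 j) (b.1 j))
        - (Matrix.of fun a b : s => ∏ j, inner ℂ (A j (a.1 j)) (A j (b.1 j))) := by
      ext a b
      simp [Finset.prod_mul_distrib, Finset.prod_pow, Matrix.gram]
    rw [e, Matrix.sub_mulVec, Matrix.smul_mulVec, dotProduct_sub, dotProduct_smul, map_sub,
      smul_eq_mul] at h
    have h' := RCLike.re_ofReal_mul (K := ℂ) ((∏ j, ‖A j‖) ^ 2)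
      (star c ⬝ᵥ (Matrix.of fun a b : s => ∏ j, inner ℂ (a.1 j) (b.1 j)).mulVec c)
    have h'' := h.trans_eq (congrArg₂ _ h' rfl)
    linarith
  · rw [Matrix.posSemidef_iff_dotProduct_mulVec]
    refine ⟨((hG _).isHermitian.smul ?_).sub (hG _).isHermitian, fun x => ?_⟩
    · simp [IsSelfAdjoint]
    · rw [Matrix.sub_mulVec, Matrix.smul_mulVec, dotProduct_sub, dotProduct_smul,
        Matrix.star_dotProduct_gram_mulVec, Matrix.star_dotProduct_gram_mulVec,
        inner_self_eq_norm_sq_to_K, inner_self_eq_norm_sq_to_K]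
      have h1 : ∑ a, x a • A j (a.1 j) = A j (∑ a, x a • a.1 j) := by simp
      rw [h1, sub_nonneg, smul_eq_mul]
      have h2 := (A j).le_opNorm (∑ a, x a • a.1 j)
      have h3 := pow_le_pow_left₀ (norm_nonneg _) h2 2
      rw [mul_pow] at h3
      have h4 := (RCLike.ofReal_le_ofReal (K := ℂ)).2 h3
      refine le_trans (le_of_eq ?_) (h4.trans (le_of_eq ?_)) <;> simp

/-- The bounded operator `⨂ j, A j` on the Hilbert space tensor power, the continuous extension of
`⨂ x ↦ ⨂ (A j (x j))`. -/
def tensorOp (A : ι → E →L[ℂ] E) : HilbertTensor ι E →L[ℂ] HilbertTensor ι E :=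
  ((algTensorMap A).mkContinuous (∏ j, ‖A j‖) (norm_algTensorMap_le A)).completion

lemma tensorOp_tprod (A : ι → E →L[ℂ] E) (x : ι → E) :
    tensorOp A (tprod x) = tprod fun j => A j (x j) := by
  simp [tensorOp, tprod, algTensorMap_algTprod]

end HilbertTensor

section Walk

variable (p : ℕ → Set.Ioo (0 : ℝ) 1)

/-- The trace `Σ_σ ⟪Z_σ, A Z_σ⟫` of an operator on `H`. For operators of trace class the value is the
same for every orthonormal basis; the canonical one is used here. -/
def trace (A : H p →L[ℂ] H p) : ℂ :=
  ∑' σ : Finset ℕ, inner ℂ (Zvec p σ) (A (Zvec p σ))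

/-- Positive operators of trace class on `H`. For a positive operator `A` one has `|A| = A`, so `A`
is of trace class iff the series of the nonnegative numbers `⟪Z_σ, A Z_σ⟫` converges. -/
def IsPosTraceClass (A : H p →L[ℂ] H p) : Prop :=
  A.IsPositive ∧ Summable fun σ : Finset ℕ => inner ℂ (Zvec p σ) (A (Zvec p σ))

/-- Nuclei over a lattice: families of positive trace class operators whose traces add up to `1`.
The lattice is `Fin d → ℤ` for `d`-dimensional nuclei and `ℤ` for `1`-dimensional ones. -/
def IsNucleus {lattice : Type} (ω : lattice → H p →L[ℂ] H p) : Prop :=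
  (∀ x, IsPosTraceClass p (ω x)) ∧ HasSum (fun x => trace p (ω x)) 1

/-- `L_n = (∂_n^* + ∂_n - I) / 2`. -/
def opL (n : ℕ) : H p →L[ℂ] H p :=
  (1 / 2 : ℂ) • ((annihilation p n).adjoint + annihilation p n - ContinuousLinearMap.id ℂ (H p))

/-- `R_n = (∂_n^* + ∂_n + I) / 2`. -/
def opR (n : ℕ) : H p →L[ℂ] H p :=
  (1 / 2 : ℂ) • ((annihilation p n).adjoint + annihilation p n + ContinuousLinearMap.id ℂ (H p))

/-- `B_n^{(ε)}`, which is `R_n` for `ε = 1` and `L_n` for `ε = -1`. -/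
def opB (n : ℕ) (ε : ℤˣ) : H p →L[ℂ] H p :=
  if ε = 1 then opR p n else opL p n

variable {d : ℕ} (K : HilbertTensor (Fin d) (H p) ≃ₗᵢ[ℂ] H p)

/-- `K T K⁻¹`, for an operator `T` on the tensor power of `H` and a unitary `K`. -/
def conjBy (T : HilbertTensor (Fin d) (H p) →L[ℂ] HilbertTensor (Fin d) (H p)) :
    H p →L[ℂ] H p :=
  (K.toContinuousLinearEquiv : HilbertTensor (Fin d) (H p) →L[ℂ] H p) ∘L T ∘L
    (K.symm.toContinuousLinearEquiv : H p →L[ℂ] HilbertTensor (Fin d) (H p))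

/-- `C_n^{(ε)} = K (⨂ j, B_n^{(ε_j)}) K⁻¹` for `ε ∈ {-1, 1}^d`. -/
def opC (n : ℕ) (ε : Fin d → ℤˣ) : H p →L[ℂ] H p :=
  conjBy p K (tensorOp fun j => opB p n (ε j))

/-- One step of the `d`-dimensional walk:
`(𝔍_n ω)(x) = Σ_ε C_n^{(ε)} ω(x - ε) C_n^{(ε)}`. -/
def step (n : ℕ) (ω : (Fin d → ℤ) → H p →L[ℂ] H p) : (Fin d → ℤ) → H p →L[ℂ] H p :=
  fun x => ∑ ε : Fin d → ℤˣ,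
    opC p K n ε ∘L ω (fun j => x j - (ε j : ℤ)) ∘L opC p K n ε

/-- The sequence of nuclei of the `d`-dimensional open QBN walk: it starts from a nucleus and
evolves by `ω^{(n+1)} = 𝔍_n ω^{(n)}`. (The maps `𝔍_n` preserve nuclei, so all `ω n` are nuclei.) -/
structure IsOpenQBNWalk (ω : ℕ → (Fin d → ℤ) → H p →L[ℂ] H p) : Prop where
  isNucleus_zero : IsNucleus p (ω 0)
  evolution : ∀ n, ω (n + 1) = step p K n (ω n)

/-- One step of the `1`-dimensional walk: `(𝔍_n ρ)(x) = L_n ρ(x+1) L_n + R_n ρ(x-1) R_n`. -/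
def stepOne (n : ℕ) (ρ : ℤ → H p →L[ℂ] H p) : ℤ → H p →L[ℂ] H p :=
  fun x => opL p n ∘L ρ (x + 1) ∘L opL p n + opR p n ∘L ρ (x - 1) ∘L opR p n

/-- The sequence `ρ^{(0)} = ρ`, `ρ^{(n+1)} = 𝔍_n ρ^{(n)}` generated by `ρ`. -/
def generated (ρ : ℤ → H p →L[ℂ] H p) : ℕ → ℤ → H p →L[ℂ] H p
  | 0 => ρ
  | n + 1 => stepOne p n (generated ρ n)

/-- Regular `1`-dimensional nuclei: for every real `t`,
`Σ_x exp(i t x / √n) Tr[ρ^{(n)}(x)] → exp(-t² / 2)` as `n → ∞`. -/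
def IsRegular (ρ : ℤ → H p →L[ℂ] H p) : Prop :=
  IsNucleus p ρ ∧ ∀ t : ℝ, Tendsto
    (fun n : ℕ => ∑' x : ℤ,
      Complex.exp (((t * x / √(n : ℝ) : ℝ) : ℂ) * Complex.I) * trace p (generated p ρ n x))
    atTop (𝓝 ((Real.exp (-t ^ 2 / 2) : ℝ) : ℂ))

end Walk

end OpenQBN

end

namespace OpenQBN

open ContinuousLinearMap (adjoint)

/-! The law of the walk factors over the coordinates. Each `opC` is a tensor product conjugated by
`K`, and summing tensor products over all sign vectors `ε` gives the tensor product of the sums over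
the single signs. Hence a separable nucleus stays separable, each factor evolving by its own
one-dimensional walk (`walk_eq_conjBy_tensorOp`). The trace of a tensor product is the product of
the traces (`trace_conjBy_tensorOp`), so the characteristic function of `X_n / √n` at `t` is a
product of the one-dimensional series that occur in regularity, taken at the coordinates `t j`. The
product of their limits is `exp (-‖t‖² / 2)`, and Lévy's continuity theorem concludes.

Two analytic points carry weight. The trace is defined through the single basis `Zvec`, which `K`
need not relate to any tensor basis; its basis independence for positive operators comes from
Hilbert-Schmidt norms of square roots (`hasSum_inner_of_isPositive`). Exchanging the finite product
with the lattice sums needs absolutely summable traces at every time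
(`isSummableNucleus_generated`). -/

lemma hasSum_mul_prod {α β : Type*} {f : α → ℂ} {g : β → ℂ} {a b : ℂ} (hf : HasSum f a)
    (hg : HasSum g b) : HasSum (fun y : α × β => f y.1 * g y.2) (a * b) := by
  have h : Summable fun y : α × β => f y.1 * g y.2 :=
    summable_mul_of_summable_norm hf.summable.norm hg.summable.norm
  exact hf.mul hg h

/-- Distributivity of finite products over absolutely convergent series. -/
lemma hasSum_prod_pi {α : Type*} {d : ℕ} {f : Fin d → α → ℂ} {a : Fin d → ℂ}
    (h : ∀ j, HasSum (f j) (a j)) :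
    HasSum (fun x : Fin d → α => ∏ j, f j (x j)) (∏ j, a j) := by
  induction d with
  | zero => simp
  | succ d ih =>
    have h1 := ih fun j => h j.succ
    have h2 := hasSum_mul_prod (h 0) h1
    rw [Fin.prod_univ_succ, ← (Fin.consEquiv fun _ : Fin (d + 1) => α).hasSum_iff]
    refine h2.congr_fun fun x => ?_
    simp [Fin.prod_univ_succ, Fin.consEquiv]

/-! ### Hilbert-Schmidt norms and basis independence of the trace -/

section Basis

variable {E F : Type*} [NormedAddCommGroup E] [InnerProductSpace ℂ E]
  [NormedAddCommGroup F] [InnerProductSpace ℂ F] {ι κ : Type*}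

/-- Parseval's identity, stated with extended nonnegative values so that double sums can later be
exchanged without summability conditions. -/
lemma tsum_enorm_inner_sq (b : HilbertBasis ι ℂ E) (x : E) :
    ∑' i, ‖inner ℂ (b i) x‖ₑ ^ 2 = ‖x‖ₑ ^ 2 := by
  have h : HasSum (fun i => ((‖inner ℂ (b i) x‖₊ ^ 2 : NNReal) : ℂ)) ((‖x‖₊ ^ 2 : NNReal) : ℂ) := by
    convert! b.hasSum_inner_mul_inner x x using 1
    · ext i
      rw [← inner_conj_symm x (b i), RCLike.conj_mul]
      simp
    · rw [inner_self_eq_norm_sq_to_K]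
      simp
  have h2 : HasSum (fun i => ‖inner ℂ (b i) x‖₊ ^ 2) (‖x‖₊ ^ 2) :=
    NNReal.hasSum_coe.1 (Complex.hasSum_ofReal.1 h)
  simpa [enorm] using (ENNReal.hasSum_coe.2 h2).tsum_eq

variable [CompleteSpace E] [CompleteSpace F]

/-- The Hilbert-Schmidt norm of the adjoint, computed in any basis. -/
lemma tsum_enorm_sq_adjoint (b : HilbertBasis ι ℂ E) (b' : HilbertBasis κ ℂ F) (B : E →L[ℂ] F) :
    ∑' i, ‖B (b i)‖ₑ ^ 2 = ∑' k, ‖adjoint B (b' k)‖ₑ ^ 2 := by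
  -- By Parseval both sides become double sums of the squared moduli of the same matrix entries, up
  -- to conjugation; Tonelli exchanges the order.
  simp_rw [← tsum_enorm_inner_sq b', ← tsum_enorm_inner_sq b (adjoint B _)]
  rw [ENNReal.tsum_comm]
  simp_rw [ContinuousLinearMap.adjoint_inner_right]
  congr! 5 with k i
  rw [← inner_conj_symm, RCLike.enorm_conj]

/-- Positive operators have self-adjoint square roots. -/
lemma exists_selfAdjoint_sq {A : E →L[ℂ] E} (hA : A.IsPositive) :
    ∃ S : E →L[ℂ] E, adjoint S = S ∧ A = S ∘L S := by
  have h : 0 ≤ A := (ContinuousLinearMap.nonneg_iff_isPositive A).2 hA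
  refine ⟨CFC.sqrt A, ?_, (CFC.sqrt_mul_sqrt_self A h).symm⟩
  exact ((ContinuousLinearMap.nonneg_iff_isPositive _).1 (CFC.sqrt_nonneg A)).isSelfAdjoint

lemma inner_adjoint_comp_self (B : E →L[ℂ] F) (x : E) :
    inner ℂ x ((adjoint B ∘L B) x) = ((‖B x‖₊ ^ 2 : NNReal) : ℂ) := by
  rw [ContinuousLinearMap.comp_apply, ContinuousLinearMap.adjoint_inner_right,
    inner_self_eq_norm_sq_to_K]
  simp

/-- The diagonal entries of `B* B` are squared norms, so the trace class condition is finiteness of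
the squared Hilbert-Schmidt norm of `B`. -/
lemma summable_inner_iff (b : ι → E) (B : E →L[ℂ] F) :
    (Summable fun i => inner ℂ (b i) ((adjoint B ∘L B) (b i))) ↔ ∑' i, ‖B (b i)‖ₑ ^ 2 ≠ ∞ := by
  simp_rw [inner_adjoint_comp_self]
  have : ∑' i, ‖B (b i)‖ₑ ^ 2 = ∑' i, ((‖B (b i)‖₊ ^ 2 : NNReal) : ℝ≥0∞) := by simp [enorm]
  rw [this, ENNReal.tsum_coe_ne_top_iff_summable, ← NNReal.summable_coe, ← Complex.summable_ofReal]

/-- No summability is assumed: in the divergent case both sides take the default value `0`. -/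
lemma tsum_inner_eq (b : ι → E) (B : E →L[ℂ] F) :
    ∑' i, inner ℂ (b i) ((adjoint B ∘L B) (b i)) = ((∑' i, ‖B (b i)‖ₑ ^ 2).toReal : ℂ) := by
  simp_rw [inner_adjoint_comp_self]
  have : ∑' i, ‖B (b i)‖ₑ ^ 2 = ∑' i, ((‖B (b i)‖₊ ^ 2 : NNReal) : ℝ≥0∞) := by simp [enorm]
  rw [this, ENNReal.tsum_toReal_eq fun _ => ENNReal.coe_ne_top, ← Complex.ofReal_tsum]
  simp

/-- The trace of a positive operator does not depend on the basis. -/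
lemma hasSum_inner_of_isPositive (b : HilbertBasis ι ℂ E) (b' : HilbertBasis κ ℂ E)
    {A : E →L[ℂ] E} (hA : A.IsPositive) {a : ℂ}
    (h : HasSum (fun i => inner ℂ (b i) (A (b i))) a) :
    HasSum (fun k => inner ℂ (b' k) (A (b' k))) a := by
  obtain ⟨S, hS, rfl⟩ := exists_selfAdjoint_sq hA
  -- With `A = S* S` the trace is the squared Hilbert-Schmidt norm of `S`; passing to the adjoint
  -- changes the basis, and `S` is its own adjoint.
  have hSS : S ∘L S = adjoint S ∘L S := by rw [hS]
  have e := tsum_enorm_sq_adjoint b b' S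
  rw [hS] at e
  rw [hSS] at h ⊢
  have hs := (summable_inner_iff b S).1 h.summable
  rw [← h.tsum_eq, tsum_inner_eq, e, ← tsum_inner_eq]
  exact ((summable_inner_iff b' S).2 (e ▸ hs)).hasSum

end Basis

/-! ### Operators and bases on the Hilbert tensor power -/

section Tensor

variable {ι E : Type*} [Fintype ι] [NormedAddCommGroup E] [InnerProductSpace ℂ E]

lemma inner_tprod (x y : ι → E) :
    inner ℂ (tprod x) (tprod y) = ∏ j, inner ℂ (x j) (y j) := by
  rw [tprod, tprod, UniformSpace.Completion.inner_coe, inner_algTprod]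

lemma norm_tprod (x : ι → E) : ‖tprod x‖ = ∏ j, ‖x j‖ := by
  refine (sq_eq_sq₀ (norm_nonneg _) (by positivity)).1 ?_
  have h := inner_tprod x x
  simp_rw [inner_self_eq_norm_sq_to_K, Finset.prod_pow] at h
  exact_mod_cast h

/-- Pure tensors span the algebraic tensor power, which is dense in its completion. -/
lemma hilbertTensor_ext {F : Type*} [NormedAddCommGroup F] [NormedSpace ℂ F]
    {S T : HilbertTensor ι E →L[ℂ] F} (h : ∀ x, S (tprod x) = T (tprod x)) : S = T := by
  ext t
  induction t using UniformSpace.Completion.induction_on with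
  | hp => exact isClosed_eq S.continuous T.continuous
  | ih t =>
    obtain ⟨s, c, rfl⟩ := algTensor_exists_sum t
    have e : ((∑ a : s, c a • algTprod ι E a.1 : AlgTensor ι E) : HilbertTensor ι E) =
        ∑ a : s, c a • tprod a.1 :=
      (map_sum (UniformSpace.Completion.toComplL (𝕜 := ℂ) (E := AlgTensor ι E)) _ _).trans
        (Finset.sum_congr rfl fun a _ => map_smul _ _ _)
    rw [e]
    simp only [map_sum, map_smul, h]

lemma tensorOp_comp (A B : ι → E →L[ℂ] E) :
    tensorOp A ∘L tensorOp B = tensorOp fun j => A j ∘L B j :=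
  hilbertTensor_ext fun x => by simp [tensorOp_tprod]

lemma adjoint_tensorOp [CompleteSpace E] (A : ι → E →L[ℂ] E) :
    adjoint (tensorOp A) = tensorOp fun j => adjoint (A j) := by
  refine hilbertTensor_ext fun x => ext_inner_right ℂ fun v => ?_
  -- The test vector `v` is arbitrary, so the two sides are compared as bounded functionals of `v`,
  -- for which pure tensors again suffice.
  have : innerSL ℂ (adjoint (tensorOp A) (tprod x)) =
      innerSL ℂ (tensorOp (fun j => adjoint (A j)) (tprod x)) := by
    refine hilbertTensor_ext fun y => ?_
    simp [ContinuousLinearMap.adjoint_inner_left, tensorOp_tprod, inner_tprod]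
  exact congrArg (fun f => f v) this

/-- Expansion of a tensor product of finite sums of operators. -/
lemma tensorOp_sum [DecidableEq ι] {α : Type*} [Fintype α] (A : ι → α → E →L[ℂ] E) :
    (tensorOp fun j => ∑ a, A j a) = ∑ r : ι → α, tensorOp fun j => A j (r j) := by
  refine hilbertTensor_ext fun x => ?_
  have e := congrArg (UniformSpace.Completion.toComplL (𝕜 := ℂ) (E := AlgTensor ι E))
    ((algTprod ι E).map_sum fun j a => A j a (x j))
  rw [map_sum] at e
  simp only [tensorOp_tprod, sum_apply]
  exact e

/-- If `A j = S j ∘L S j` with `S j` self-adjoint, the tensor product is `T* T`, where `T` is the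
tensor product of the `S j`. -/
lemma isPositive_tensorOp [CompleteSpace E] {A : ι → E →L[ℂ] E} (hA : ∀ j, (A j).IsPositive) :
    (tensorOp A).IsPositive := by
  choose S hS hSA using fun j => exists_selfAdjoint_sq (hA j)
  have : tensorOp A = adjoint (tensorOp S) ∘L tensorOp S := by
    simp_rw [adjoint_tensorOp, tensorOp_comp, hS, ← hSA]
  rw [this]
  exact ContinuousLinearMap.isPositive_adjoint_comp_self _

lemma orthonormal_tprod {κ : Type*} {b : κ → E} (hb : Orthonormal ℂ b) :
    Orthonormal ℂ fun r : ι → κ => tprod fun j => b (r j) := by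
  classical
  refine orthonormal_iff_ite.2 fun r s => ?_
  simp_rw [inner_tprod, orthonormal_iff_ite.1 hb]
  simp [Finset.prod_ite_zero, funext_iff]

/-- This is the totality half of the tensor basis: basis vectors are replaced by arbitrary vectors
one slot at a time. -/
lemma inner_tprod_eq_zero {κ : Type*} (b : HilbertBasis κ ℂ E) {v : HilbertTensor ι E}
    (hv : ∀ r : ι → κ, inner ℂ v (tprod fun j => b (r j)) = 0) (x : ι → E) :
    inner ℂ v (tprod x) = 0 := by
  classical
  -- `s` is the set of slots already freed; outside `s` the entries are still basis vectors.
  suffices h : ∀ (s : Finset ι) (x : ι → E), (∀ j ∉ s, x j ∈ Set.range b) →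
      inner ℂ v (tprod x) = 0 from h Finset.univ x (by simp)
  intro s
  induction s using Finset.induction_on with
  | empty =>
    intro x hx
    choose r hr using fun j => hx j (by simp)
    simpa [hr] using hv r
  | insert i s hi ih =>
    intro x hx
    -- With the other slots frozen, the inner product is a bounded functional of slot `i`. It
    -- vanishes on `b` by induction, hence everywhere by density of the span.
    let f : E →L[ℂ] ℂ := innerSL ℂ v ∘L
      (LinearMap.mkContinuous
        ((UniformSpace.Completion.toComplL (𝕜 := ℂ) (E := AlgTensor ι E)).toLinearMap ∘ₗ
          (algTprod ι E).toLinearMap x i) (∏ j ∈ Finset.univ.erase i, ‖x j‖) fun y => by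
        change ‖tprod (Function.update x i y)‖ ≤ _
        rw [norm_tprod, ← Finset.prod_erase_mul _ _ (Finset.mem_univ i), Function.update_self]
        refine (congrArg (· * ‖y‖) (Finset.prod_congr rfl fun j hj => ?_)).le
        rw [Function.update_of_ne (Finset.ne_of_mem_erase hj)])
    have hf : ∀ y, f y = inner ℂ v (tprod (Function.update x i y)) := fun y => rfl
    have h0 : f = 0 := by
      refine ContinuousLinearMap.ext_on (s := Set.range b) ?_ ?_
      · rw [Submodule.dense_iff_topologicalClosure_eq_top]
        exact b.dense_span
      · rintro _ ⟨k, rfl⟩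
        rw [hf]
        refine ih _ fun j hj => ?_
        by_cases hji : j = i
        · subst hji; simp
        · rw [Function.update_of_ne hji]
          exact hx j (by simp [hj, hji])
    have := hf (x i)
    rwa [Function.update_eq_self, h0, zero_apply, eq_comm] at this

/-- The tensor power of a Hilbert basis. -/
noncomputable def tensorBasis {κ : Type*} (ι : Type*) [Fintype ι] (b : HilbertBasis κ ℂ E) :
    HilbertBasis (ι → κ) ℂ (HilbertTensor ι E) :=
  HilbertBasis.mkOfOrthogonalEqBot (orthonormal_tprod b.orthonormal) (by
    refine (Submodule.eq_bot_iff _).2 fun v hv => ?_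
    -- A vector orthogonal to the basis tensors is orthogonal to all pure tensors, so its functional
    -- is zero; evaluating it at `v` gives `v = 0`.
    have h : innerSL ℂ v = 0 := hilbertTensor_ext fun x => by
      refine inner_tprod_eq_zero b (fun r => ?_) x
      rw [← inner_conj_symm, hv _ (Submodule.subset_span ⟨r, rfl⟩), map_zero]
    exact inner_self_eq_zero.1 (congrArg (fun f => f v) h))

lemma tensorBasis_apply {κ : Type*} (b : HilbertBasis κ ℂ E) (r : ι → κ) :
    tensorBasis ι b r = tprod fun j => b (r j) := by
  simp [tensorBasis]

end Tensor

/-! ### Trace class operators under sums and conjugation -/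

section Trace

variable {p : ℕ → Set.Ioo (0 : ℝ) 1}

lemma IsPosTraceClass.add {A B : H p →L[ℂ] H p} (hA : IsPosTraceClass p A)
    (hB : IsPosTraceClass p B) : IsPosTraceClass p (A + B) := by
  refine ⟨hA.1.add hB.1, (hA.2.add hB.2).congr fun σ => ?_⟩
  rw [add_apply, inner_add_right]

lemma trace_add {A B : H p →L[ℂ] H p} (hA : IsPosTraceClass p A)
    (hB : IsPosTraceClass p B) : trace p (A + B) = trace p A + trace p B := by
  rw [trace, trace, trace, ← hA.2.tsum_add hB.2]
  simp_rw [add_apply, inner_add_right]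

/-- For `A = S ∘L S` with `S` self-adjoint, the conjugate is `(S B)* (S B)`, so its trace is the
squared Hilbert-Schmidt norm of `S B`. -/
lemma isPosTraceClass_conj {A B : H p →L[ℂ] H p} (hB : adjoint B = B)
    (hA : IsPosTraceClass p A) :
    IsPosTraceClass p (B ∘L A ∘L B) ∧ ‖trace p (B ∘L A ∘L B)‖ ≤ ‖B‖ ^ 2 * ‖trace p A‖ := by
  obtain ⟨hpos, hsum⟩ := hA
  obtain ⟨S, hS, rfl⟩ := exists_selfAdjoint_sq hpos
  have e1 : S ∘L S = adjoint S ∘L S := by rw [hS]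
  have e2 : B ∘L (S ∘L S) ∘L B = adjoint (S ∘L B) ∘L (S ∘L B) := by
    rw [ContinuousLinearMap.adjoint_comp, hS, hB]
    rfl
  rw [e1] at hsum
  have hfin := (summable_inner_iff (Zvec p) S).1 hsum
  have hle : ∑' σ, ‖(S ∘L B) (Zvec p σ)‖ₑ ^ 2 ≤ ‖B‖ₑ ^ 2 * ∑' σ, ‖S (Zvec p σ)‖ₑ ^ 2 := by
    -- The adjoint of `S B` is `B S`, which puts `B` on the outside, where its operator norm gives a
    -- termwise bound.
    have h := tsum_enorm_sq_adjoint (canonicalBasis p) (canonicalBasis p) (S ∘L B)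
    simp_rw [canonicalBasis_apply, ContinuousLinearMap.adjoint_comp, hS, hB] at h
    rw [h, ← ENNReal.tsum_mul_left]
    refine ENNReal.tsum_le_tsum fun σ => ?_
    rw [← mul_pow]
    exact pow_le_pow_left₀ zero_le (B.le_opENorm _) 2
  have hfin' : ‖B‖ₑ ^ 2 * ∑' σ, ‖S (Zvec p σ)‖ₑ ^ 2 ≠ ∞ :=
    ENNReal.mul_ne_top (by simp) hfin
  refine ⟨⟨?_, ?_⟩, ?_⟩
  · rw [e2]
    exact ContinuousLinearMap.isPositive_adjoint_comp_self _
  · rw [e2]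
    exact (summable_inner_iff _ _).2 (ne_top_of_le_ne_top hfin' hle)
  · rw [trace, trace, e2, e1, tsum_inner_eq, tsum_inner_eq]
    simp only [Complex.norm_real, Real.norm_eq_abs, abs_of_nonneg ENNReal.toReal_nonneg]
    have := ENNReal.toReal_mono hfin' hle
    simpa [ENNReal.toReal_mul] using this

end Trace

/-! ### Evolution of nuclei and factorisation of the walk -/

section Walk

variable (p : ℕ → Set.Ioo (0 : ℝ) 1)

lemma adjoint_opB (n : ℕ) (ε : ℤˣ) : adjoint (opB p n ε) = opB p n ε := by
  have h1 : adjoint (ContinuousLinearMap.id ℂ (H p)) = ContinuousLinearMap.id ℂ (H p) :=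
    ContinuousLinearMap.adjoint_id
  have h2 : (starRingEnd ℂ) (1 / 2 : ℂ) = 1 / 2 := by
    rw [map_div₀, map_one, Complex.conj_ofNat]
  rw [opB]
  split_ifs <;> simp only [opL, opR, map_smulₛₗ, map_add, map_sub, h1, h2,
    ContinuousLinearMap.adjoint_adjoint] <;> congr 2 <;> exact add_comm _ _

/-- This form matches `step` sign by sign, so that `tensorOp_sum` can expand a tensor product of
one-dimensional steps. -/
lemma stepOne_eq_sum (n : ℕ) (ρ : ℤ → H p →L[ℂ] H p) (x : ℤ) :
    stepOne p n ρ x = ∑ ε : ℤˣ, opB p n ε ∘L ρ (x - ε) ∘L opB p n ε := by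
  rw [Fintype.sum_eq_add (1 : ℤˣ) (-1) (by decide) (by
    rintro ε ⟨h1, h2⟩
    exact ((Int.units_eq_one_or ε).elim h1 h2).elim)]
  have : (-1 : ℤˣ) ≠ 1 := by decide
  simp [stepOne, opB, this, add_comm]

/-- The part of being a nucleus that the one-dimensional evolution is used for: positive trace
class operators with summable traces. -/
def IsSummableNucleus (ρ : ℤ → H p →L[ℂ] H p) : Prop :=
  (∀ x, IsPosTraceClass p (ρ x)) ∧ Summable fun x => trace p (ρ x)

/-- Conjugation by a fixed self-adjoint operator enlarges traces by at most its squared norm, so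
summability survives without knowing that the step preserves total trace. -/
lemma isSummableNucleus_stepOne (n : ℕ) {ρ : ℤ → H p →L[ℂ] H p} (h : IsSummableNucleus p ρ) :
    IsSummableNucleus p (stepOne p n ρ) := by
  have hL : adjoint (opL p n) = opL p n := by
    have h := adjoint_opB p n (-1)
    rwa [opB, if_neg (by decide)] at h
  have hR : adjoint (opR p n) = opR p n := by
    have h := adjoint_opB p n 1
    rwa [opB, if_pos rfl] at h
  have cL := fun x => isPosTraceClass_conj hL (h.1 x)
  have cR := fun x => isPosTraceClass_conj hR (h.1 x)
  refine ⟨fun x => (cL _).1.add (cR _).1, ?_⟩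
  have sL : Summable fun x => trace p (opL p n ∘L ρ x ∘L opL p n) :=
    (h.2.norm.mul_left _).of_norm_bounded fun x => (cL x).2
  have sR : Summable fun x => trace p (opR p n ∘L ρ x ∘L opR p n) :=
    (h.2.norm.mul_left _).of_norm_bounded fun x => (cR x).2
  -- The shifts by one only reindex the lattice sums.
  refine (((Equiv.addRight (1 : ℤ)).summable_iff.2 sL).add
    ((Equiv.subRight (1 : ℤ)).summable_iff.2 sR)).congr fun x => ?_
  exact (trace_add (cL (x + 1)).1 (cR (x - 1)).1).symm

lemma isSummableNucleus_generated {ρ : ℤ → H p →L[ℂ] H p} (h : IsNucleus p ρ) (n : ℕ) :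
    IsSummableNucleus p (generated p ρ n) := by
  induction n with
  | zero => exact ⟨h.1, h.2.summable⟩
  | succ n ih => exact isSummableNucleus_stepOne p n ih

variable {d : ℕ} (K : HilbertTensor (Fin d) (H p) ≃ₗᵢ[ℂ] H p)

lemma conjBy_comp (S T : HilbertTensor (Fin d) (H p) →L[ℂ] HilbertTensor (Fin d) (H p)) :
    conjBy p K S ∘L conjBy p K T = conjBy p K (S ∘L T) := by
  ext1 x
  simp [conjBy]

lemma conjBy_sum {α : Type*} (s : Finset α)
    (T : α → HilbertTensor (Fin d) (H p) →L[ℂ] HilbertTensor (Fin d) (H p)) :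
    conjBy p K (∑ a ∈ s, T a) = ∑ a ∈ s, conjBy p K (T a) := by
  ext1 x
  simp [conjBy]

/-- The walk started from a separable nucleus stays separable, and its factors evolve by the
one-dimensional walk. -/
lemma walk_eq_conjBy_tensorOp {ω : ℕ → (Fin d → ℤ) → H p →L[ℂ] H p} (hω : IsOpenQBNWalk p K ω)
    {ρ : Fin d → ℤ → H p →L[ℂ] H p}
    (hsep : ∀ x, ω 0 x = conjBy p K (tensorOp fun j => ρ j (x j))) (n : ℕ) (x : Fin d → ℤ) :
    ω n x = conjBy p K (tensorOp fun j => generated p (ρ j) n (x j)) := by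
  induction n generalizing x with
  | zero => exact hsep x
  | succ n ih =>
    rw [hω.evolution, step]
    -- Both sides become the same sum over `ε` of conjugated tensor products with `j`-th factor `B
    -- ρ_j(x j - ε j) B`. The induction hypothesis is needed at the shifted points, hence for all
    -- `x`.
    simp_rw [generated, stepOne_eq_sum, tensorOp_sum, conjBy_sum, ih, opC, conjBy_comp,
      tensorOp_comp]

/-- In the tensor basis the diagonal entries are products, so the series factors. Positivity then
transfers the value to the basis that `K` maps to `Zvec`. -/
lemma trace_conjBy_tensorOp {A : Fin d → H p →L[ℂ] H p} (hA : ∀ j, IsPosTraceClass p (A j)) :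
    trace p (conjBy p K (tensorOp A)) = ∏ j, trace p (A j) := by
  have h1 : HasSum (fun r : Fin d → Finset ℕ =>
      inner ℂ (tensorBasis (Fin d) (canonicalBasis p) r)
        (tensorOp A (tensorBasis (Fin d) (canonicalBasis p) r))) (∏ j, trace p (A j)) := by
    simp_rw [tensorBasis_apply, tensorOp_tprod, inner_tprod, canonicalBasis_apply]
    exact hasSum_prod_pi (f := fun j σ => inner ℂ (Zvec p σ) (A j (Zvec p σ)))
      (a := fun j => trace p (A j)) fun j => (hA j).2.hasSum
  have h2 := hasSum_inner_of_isPositive _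
    (HilbertBasis.ofRepr (K.trans (canonicalBasis p).repr))
    (isPositive_tensorOp fun j => (hA j).1) h1
  have h3 : ∀ σ, HilbertBasis.ofRepr (K.trans (canonicalBasis p).repr) σ = K.symm (Zvec p σ) := by
    intro σ
    rw [← canonicalBasis_apply, ← HilbertBasis.repr_symm_single, ← HilbertBasis.repr_symm_single]
    rfl
  rw [trace, ← h2.tsum_eq]
  refine tsum_congr fun σ => ?_
  rw [h3, ← K.inner_map_map, K.apply_symm_apply]
  rfl

end Walk

/-! ### Characteristic functions and the central limit theorem -/

/-- The characteristic function of a rescaled lattice valued random vector, as a series. -/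
lemma charFun_map_lattice {Ω : Type*} [MeasurableSpace Ω] (P : Measure Ω) [IsProbabilityMeasure P]
    {d : ℕ} {X : Ω → Fin d → ℤ} (hX : Measurable X) (s : ℝ) (t : EuclideanSpace ℝ (Fin d)) :
    charFun (P.map fun a => (WithLp.toLp 2 fun j => (X a j : ℝ) / s : EuclideanSpace ℝ (Fin d))) t =
      ∑' x : Fin d → ℤ, (∏ j, Complex.exp (((t j * x j / s : ℝ) : ℂ) * Complex.I)) *
        (P.real {a | X a = x} : ℂ) := by
  let g : (Fin d → ℤ) → EuclideanSpace ℝ (Fin d) := fun x => WithLp.toLp 2 fun j => (x j : ℝ) / s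
  have hg : Measurable g := measurable_of_countable _
  have e : (P.map fun a => (WithLp.toLp 2 fun j => (X a j : ℝ) / s : EuclideanSpace ℝ (Fin d))) =
      (P.map X).map g := by rw [Measure.map_map hg hX]; rfl
  have := Measure.isProbabilityMeasure_map (μ := P) hX.aemeasurable
  rw [e, charFun_apply, integral_map hg.aemeasurable (by fun_prop), integral_countable]
  · refine tsum_congr fun x => ?_
    rw [map_measureReal_apply hX (measurableSet_singleton x), Complex.real_smul,
      mul_comm, ← Complex.exp_sum]
    change _ = _ * ((P.real (X ⁻¹' {x}) : ℝ) : ℂ)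
    rw [← Finset.sum_mul]
    congr 3
    rw [PiLp.inner_apply]
    push_cast
    refine Finset.sum_congr rfl fun j _ => ?_
    simp [g]
    ring
  · refine Integrable.of_bound (C := 1) (measurable_of_countable _).aestronglyMeasurable
      (ae_of_all _ fun x => ?_)
    rw [Complex.norm_exp_ofReal_mul_I]

end OpenQBN

theorem theorem3p5 (p : ℕ → Set.Ioo (0 : ℝ) 1) {d : ℕ} (hd : 2 ≤ d)
    (K : OpenQBN.HilbertTensor (Fin d) (OpenQBN.H p) ≃ₗᵢ[ℂ] OpenQBN.H p)
    (ω : ℕ → (Fin d → ℤ) → OpenQBN.H p →L[ℂ] OpenQBN.H p)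
    (hω : OpenQBN.IsOpenQBNWalk p K ω)
    (ρ : Fin d → ℤ → OpenQBN.H p →L[ℂ] OpenQBN.H p)
    (hρ : ∀ j, OpenQBN.IsRegular p (ρ j))
    (hsep : ∀ x : Fin d → ℤ,
      ω 0 x = OpenQBN.conjBy p K (OpenQBN.tensorOp fun j => ρ j (x j)))
    {Ω : ℕ → Type*} [∀ n, MeasurableSpace (Ω n)]
    (P : (n : ℕ) → Measure (Ω n)) [∀ n, IsProbabilityMeasure (P n)]
    (X : (n : ℕ) → Ω n → Fin d → ℤ) (hX : ∀ n, Measurable (X n))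
    (hlaw : ∀ (n : ℕ) (x : Fin d → ℤ),
      (((P n).real {a | X n a = x} : ℝ) : ℂ) = OpenQBN.trace p (ω n x)) :
    TendstoInDistribution
      (fun (n : ℕ) (a : Ω n) =>
        (WithLp.toLp 2 fun j => (X n a j : ℝ) / √(n : ℝ) : EuclideanSpace ℝ (Fin d)))
      atTop (id : EuclideanSpace ℝ (Fin d) → EuclideanSpace ℝ (Fin d)) P
      (stdGaussian (EuclideanSpace ℝ (Fin d))) := by
  refine ⟨fun n => ?_, measurable_id.aemeasurable,
    ProbabilityMeasure.tendsto_iff_tendsto_charFun.2 fun t => ?_⟩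
  · have hg : Measurable fun x : Fin d → ℤ =>
        (WithLp.toLp 2 fun j => (x j : ℝ) / √(n : ℝ) : EuclideanSpace ℝ (Fin d)) :=
      measurable_of_countable _
    exact (hg.comp (hX n)).aemeasurable
  · have hnuc := fun j => OpenQBN.isSummableNucleus_generated p (hρ j).1
    -- This includes `n = 0`, where both sides use the convention that division by `√0` gives `0`.
    have key : ∀ n, charFun ((P n).map fun a =>
        (WithLp.toLp 2 fun j => (X n a j : ℝ) / √(n : ℝ) : EuclideanSpace ℝ (Fin d))) t =
        ∏ j, ∑' x : ℤ, Complex.exp (((t j * x / √(n : ℝ) : ℝ) : ℂ) * Complex.I) *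
          OpenQBN.trace p (OpenQBN.generated p (ρ j) n x) := by
      intro n
      rw [OpenQBN.charFun_map_lattice (P n) (hX n)]
      refine HasSum.tsum_eq ?_
      simp_rw [hlaw, OpenQBN.walk_eq_conjBy_tensorOp p K hω hsep,
        OpenQBN.trace_conjBy_tensorOp p K fun j => (hnuc j n).1 _, ← Finset.prod_mul_distrib]
      refine OpenQBN.hasSum_prod_pi (f := fun j (x : ℤ) =>
        Complex.exp (((t j * x / √(n : ℝ) : ℝ) : ℂ) * Complex.I) *
          OpenQBN.trace p (OpenQBN.generated p (ρ j) n x)) fun j => Summable.hasSum ?_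
      -- The phases have modulus one, so the summable traces dominate.
      refine (hnuc j n).2.norm.of_norm_bounded fun x => ?_
      rw [norm_mul, Complex.norm_exp_ofReal_mul_I, one_mul]
    have hlim := tendsto_finsetProd Finset.univ fun j _ => (hρ j).2 (t j)
    simp only [ProbabilityMeasure.coe_mk, key, Measure.map_id, charFun_stdGaussian]
    convert! hlim using 2
    -- It remains to match exponents: the sum of `-(t j)² / 2` is `-‖t‖² / 2`.
    rw [← Complex.ofReal_prod, ← Real.exp_sum, ← Complex.ofReal_pow, EuclideanSpace.norm_sq_eq]
    push_cast
    rw [← Finset.sum_div, Finset.sum_neg_distrib]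
    congr 3
    exact Finset.sum_congr rfl fun j _ => by norm_cast; simp
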